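/- Let $H$ be a finite acyclic digraph (that is, one with no directed cycle, so in particular without loops or pairs of opposite edges) on $h$ vertices. Let $G$ be a finite simple undirected graph on $n$ vertices with minimum degree $\delta(G)$, where $h \mid n$ and $$\delta(G) \ge n\left(1-\frac{1}{4^h}\right)+4^h .$$ Then every orientation $\vec G$ of $G$ (a digraph obtained by giving each edge of $G$ exactly one of its two directions) has an $H$-factor, i.e. $\vec G$ contains pairwise vertex-disjoint copies of $H$, as not necessarily induced subdigraphs, that together cover all vertices of $\vec G$. -/

import Mathlib

namespace Digraph

/-- A digraph is acyclic if no vertex can be reached from itself by a directed walk with at least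
one edge. In particular there are no loops and no pairs of opposite edges. -/
def IsAcyclic {W : Type*} (H : Digraph W) : Prop :=
  ∀ w : W, ¬ Relation.TransGen H.Adj w w

/-- `D` is an orientation of the simple graph `G`: it is obtained by giving each edge of `G`
exactly one of its two directions. -/
structure IsOrientation {V : Type*} (D : Digraph V) (G : SimpleGraph V) : Prop where
  adj_iff : ∀ u v : V, G.Adj u v ↔ D.Adj u v ∨ D.Adj v u
  asymm : ∀ u v : V, D.Adj u v → ¬ D.Adj v u

/-- A copy of `H` in `D`: an injection of the vertices of `H` into those of `D` that maps directed
edges to directed edges (the copy need not be an induced subdigraph). -/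
structure Copy {W V : Type*} (H : Digraph W) (D : Digraph V) where
  toEmbedding : W ↪ V
  map_adj : ∀ a b : W, H.Adj a b → D.Adj (toEmbedding a) (toEmbedding b)

/-- The vertex set of a copy. -/
def Copy.verts {W V : Type*} {H : Digraph W} {D : Digraph V} (c : Copy H D) : Set V :=
  Set.range c.toEmbedding

/-- `D` has an `H`-factor: there are pairwise vertex-disjoint copies of `H` in `D` that together
cover all vertices of `D`. -/
def HasFactor {V W : Type*} (D : Digraph V) (H : Digraph W) : Prop :=
  ∃ F : Set (Copy H D),
    F.Pairwise (fun c c' => Disjoint c.verts c'.verts) ∧ ⋃ c ∈ F, c.verts = Set.univ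

end Digraph

/-!
An acyclic digraph on `h` vertices embeds into the transitive tournament `T_h`, so it suffices to
tile the vertices of the orientation with copies of `T_h`.

Let `d` be the maximal number of non-neighbours of a vertex (itself included); the degree
hypothesis says `n ≥ 4 ^ h * d + 16 ^ h`. Passing repeatedly to the larger of the out- and the
in-neighbourhood shows that every set with more than `(2 ^ k - 1) * d` vertices contains a
`T_{k+1}` (`exists_isTransTournament`). Hence disjoint copies of `T_{2h}` can be picked greedily
until they cover about half of the vertices, and disjoint copies of `T_h` in the remainder until at
most `(2 ^ (h - 1) - 1) * d` vertices are left over (`exists_greedy_family`).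

The copies of `T_{2h}` serve as absorbers: if `A` is one of them, `u ∈ A`, and `v ∉ A` is adjacent
to all but at most two vertices of `A`, then `A - u + v` can be tiled with `T_h`, because `v` together
with `h - 1` out-neighbours (or in-neighbours) in `A - u` is a `T_h`, and what remains is transitive
(`IsTransTournament.tileable_swap`). So `v` may be exchanged for any vertex `u` of `A`. Given `h`
leftover vertices, almost all absorbers are suitable for all of them, and the union of the suitable
ones contains a `T_h` whose vertices `u` lie in distinct absorbers. Exchanging the leftover vertices
for these `u` and using the new `T_h` as a tile decreases the leftover by `h`, at the price of `h`
absorbers; there are enough absorbers to finish in this way (`tileable_biUnion_union`).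
-/

namespace Digraph

open Finset

/-! ### Transitive tournaments -/

/-- The relation `R` contains a transitive tournament with vertex set `S`: the elements of `S` can
be listed in such a way that each is `R`-related to all the later ones. For irreflexive `R` the list
has no repetitions. -/
def IsTransTournament {V : Type*} (R : V → V → Prop) (S : Finset V) : Prop :=
  ∃ l : List V, l.Pairwise R ∧ ∀ x, x ∈ l ↔ x ∈ S

namespace IsTransTournament

variable {V : Type*} {R R' : V → V → Prop} {S T : Finset V}

theorem subset (hS : IsTransTournament R S) (h : T ⊆ S) : IsTransTournament R T := by
  classical
  obtain ⟨l, hl, hm⟩ := hS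
  refine ⟨l.filter (· ∈ T), hl.sublist List.filter_sublist, fun x => ?_⟩
  simp only [List.mem_filter, hm, decide_eq_true_eq]
  exact ⟨fun hx => hx.2, fun hx => ⟨h hx, hx⟩⟩

theorem mono (hS : IsTransTournament R S) (h : ∀ x y, R x y → R' x y) :
    IsTransTournament R' S := by
  obtain ⟨l, hl, hm⟩ := hS
  exact ⟨l, hl.imp (fun {a b} hab => h a b hab), hm⟩

theorem insert_source [DecidableEq V] (hS : IsTransTournament R S) {v : V}
    (hv : ∀ x ∈ S, R v x) : IsTransTournament R (insert v S) := by
  obtain ⟨l, hl, hm⟩ := hS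
  refine ⟨v :: l, List.pairwise_cons.2 ⟨fun x hx => hv x ((hm x).1 hx), hl⟩, fun x => ?_⟩
  simp [hm]

theorem insert_sink [DecidableEq V] (hS : IsTransTournament R S) {v : V}
    (hv : ∀ x ∈ S, R x v) : IsTransTournament R (insert v S) := by
  obtain ⟨l, hl, hm⟩ := hS
  refine ⟨l ++ [v], List.pairwise_append.2 ⟨hl, by simp, ?_⟩, fun x => ?_⟩
  · intro x hx y hy
    obtain rfl : y = v := by simpa using hy
    exact hv x ((hm x).1 hx)
  · simp [hm, or_comm]

theorem total (hS : IsTransTournament R S) {x y : V} (hx : x ∈ S) (hy : y ∈ S) (hne : x ≠ y) :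
    R x y ∨ R y x := by
  obtain ⟨l, hl, hm⟩ := hS
  obtain ⟨i, rfl⟩ := List.get_of_mem ((hm x).2 hx)
  obtain ⟨j, rfl⟩ := List.get_of_mem ((hm y).2 hy)
  rcases lt_trichotomy i j with hij | rfl | hij
  · exact .inl (List.pairwise_iff_get.1 hl i j hij)
  · exact absurd rfl hne
  · exact .inr (List.pairwise_iff_get.1 hl j i hij)

end IsTransTournament

/-- A set with more than `(2 ^ k - 1) * d` vertices, each of which has at most `d` non-neighbours
in it, contains a transitive tournament on `k + 1` vertices. -/
theorem exists_isTransTournament {V : Type*} {R : V → V → Prop} (hirr : ∀ x, ¬ R x x) {d : ℕ}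
    (k : ℕ) (S : Finset V) [∀ v, DecidablePred fun u => ¬ (R v u ∨ R u v)]
    (hS : ∀ v ∈ S, #{u ∈ S | ¬ (R v u ∨ R u v)} ≤ d) (hc : (2 ^ k - 1) * d < #S) :
    ∃ T ⊆ S, #T = k + 1 ∧ IsTransTournament R T := by
  classical
  induction k generalizing S with
  | zero =>
    obtain ⟨v, hv⟩ : S.Nonempty := card_pos.1 (by omega)
    exact ⟨{v}, by simpa using hv, by simp, [v], by simp, by simp⟩
  | succ k ih =>
    obtain ⟨v, hv⟩ : S.Nonempty := card_pos.1 (by omega)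
    have hsplit : #S ≤ #{u ∈ S | R v u} + #{u ∈ S | R u v} + d := by
      have h1 := card_filter_add_card_filter_not (s := S) (fun u => R v u ∨ R u v)
      have h2 : #{u ∈ S | R v u ∨ R u v} ≤ #{u ∈ S | R v u} + #{u ∈ S | R u v} := by
        rw [filter_or]
        exact card_union_le _ _
      have h3 := hS v hv
      have h4 : #{u ∈ S | ¬ (R v u ∨ R u v)} ≤ d := by convert h3
      omega
    have hpow : (2 ^ (k + 1) - 1) * d = 2 * ((2 ^ k - 1) * d) + d := by
      obtain ⟨m, hm⟩ := Nat.exists_eq_add_of_le (Nat.one_le_two_pow (n := k))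
      have h1 : 2 ^ k - 1 = m := by omega
      have h2 : 2 ^ (k + 1) - 1 = 2 * m + 1 := by rw [pow_succ]; omega
      rw [h1, h2]; ring
    have hsub : ∀ P : V → Prop, ∀ w ∈ S.filter P,
        #{u ∈ S.filter P | ¬ (R w u ∨ R u w)} ≤ d := fun P w hw =>
      (card_le_card (filter_subset_filter _ (filter_subset _ _))).trans (hS w (mem_filter.1 hw).1)
    by_cases hout : (2 ^ k - 1) * d < #{u ∈ S | R v u}
    · obtain ⟨T, hT, hTc, hTt⟩ := ih _ (hsub _) hout
      refine ⟨insert v T, insert_subset hv (hT.trans (filter_subset _ _)), ?_,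
        hTt.insert_source fun x hx => (mem_filter.1 (hT hx)).2⟩
      rw [card_insert_of_notMem fun h => hirr v (mem_filter.1 (hT h)).2, hTc]
    · obtain ⟨T, hT, hTc, hTt⟩ := ih {u ∈ S | R u v} (hsub _) (by omega)
      refine ⟨insert v T, insert_subset hv (hT.trans (filter_subset _ _)), ?_,
        hTt.insert_sink fun x hx => (mem_filter.1 (hT hx)).2⟩
      rw [card_insert_of_notMem fun h => hirr v (mem_filter.1 (hT h)).2, hTc]

/-- Picking disjoint transitive tournaments on `k + 1` vertices greedily inside `S` leaves at most
`(2 ^ k - 1) * d` vertices uncovered. -/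
theorem exists_greedy_family {V : Type*} [DecidableEq V] {R : V → V → Prop} (hirr : ∀ x, ¬ R x x)
    {d : ℕ} (k : ℕ) [∀ v, DecidablePred fun u => ¬ (R v u ∨ R u v)] (S : Finset V)
    (hS : ∀ v ∈ S, #{u ∈ S | ¬ (R v u ∨ R u v)} ≤ d) :
    ∃ 𝒜 : Finset (Finset V), (∀ A ∈ 𝒜, IsTransTournament R A ∧ #A = k + 1) ∧
      (𝒜 : Set (Finset V)).PairwiseDisjoint id ∧ 𝒜.biUnion id ⊆ S ∧
      #(S \ 𝒜.biUnion id) ≤ (2 ^ k - 1) * d := by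
  induction S using Finset.strongInduction with
  | H S ih =>
    by_cases hc : (2 ^ k - 1) * d < #S
    · obtain ⟨T, hTS, hTc, hTt⟩ := exists_isTransTournament hirr k S hS hc
      have hTne : T.Nonempty := card_pos.1 (by omega)
      obtain ⟨𝒜, h1, h2, h3, h4⟩ := ih (S \ T) (sdiff_ssubset hTS hTne) fun v hv =>
        (card_le_card (filter_subset_filter _ sdiff_subset)).trans (hS v (mem_sdiff.1 hv).1)
      refine ⟨insert T 𝒜, ?_, ?_, ?_, ?_⟩
      · intro A hA
        rcases mem_insert.1 hA with rfl | hA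
        exacts [⟨hTt, hTc⟩, h1 A hA]
      · rw [coe_insert]
        refine h2.insert fun A hA _ => ?_
        have hA' : A ⊆ S \ T := (subset_biUnion_of_mem id hA).trans h3
        exact (disjoint_sdiff_self_left.mono_left hA').symm
      · rw [biUnion_insert]
        exact union_subset hTS (h3.trans sdiff_subset)
      · rw [biUnion_insert, id]
        refine le_trans (card_le_card ?_) h4
        intro x
        simp only [mem_sdiff, mem_union]
        tauto
    · exact ⟨∅, by simp, by simp, by simp, by simpa using hc⟩

/-! ### Tilings by transitive tournaments -/

/-- `Tileable R h S`: the set `S` is a disjoint union of sets of size `h` that carry transitive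
tournaments of `R`. -/
inductive Tileable {V : Type*} [DecidableEq V] (R : V → V → Prop) (h : ℕ) : Finset V → Prop
  | empty : Tileable R h ∅
  | union {S T : Finset V} (hS : Tileable R h S) (hT : IsTransTournament R T) (hc : #T = h)
      (hd : Disjoint S T) : Tileable R h (S ∪ T)

namespace Tileable

variable {V : Type*} [DecidableEq V] {R : V → V → Prop} {h : ℕ} {S T : Finset V}

theorem of_isTransTournament (hT : IsTransTournament R T) (hc : #T = h) : Tileable R h T := by
  simpa using Tileable.empty.union hT hc (disjoint_empty_left T)

theorem disjoint_union (hS : Tileable R h S) (hT : Tileable R h T) (hd : Disjoint S T) :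
    Tileable R h (S ∪ T) := by
  induction hT with
  | empty => simpa using hS
  | @union T₁ T₂ _ hT₂ hc hd' ih =>
    rw [disjoint_union_right] at hd
    rw [← union_assoc]
    exact (ih hd.1).union hT₂ hc (disjoint_union_left.2 ⟨hd.2, hd'⟩)

theorem biUnion {ι : Type*} [DecidableEq ι] {s : Finset ι} {f : ι → Finset V}
    (hf : ∀ i ∈ s, Tileable R h (f i)) (hd : (s : Set ι).PairwiseDisjoint f) :
    Tileable R h (s.biUnion f) := by
  induction s using Finset.induction_on with
  | empty => simpa using Tileable.empty
  | insert i s hi ih =>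
    rw [biUnion_insert]
    refine (hf i (mem_insert_self i s)).disjoint_union
      (ih (fun j hj => hf j (mem_insert_of_mem hj)) (hd.subset (by simp))) ?_
    rw [disjoint_biUnion_right]
    intro j hj
    exact hd (by simp) (by simp [hj]) (fun hij => hi (hij ▸ hj))

end Tileable

namespace IsTransTournament

variable {V : Type*} [DecidableEq V] {R : V → V → Prop} {h : ℕ}

theorem tileable {S : Finset V} (hS : IsTransTournament R S) (hdvd : h ∣ #S) :
    Tileable R h S := by
  obtain ⟨m, hm⟩ := hdvd
  induction m generalizing S with
  | zero =>
    obtain rfl : S = ∅ := card_eq_zero.1 (by simpa using hm)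
    exact Tileable.empty
  | succ m ih =>
    obtain ⟨T, hTS, hTc⟩ := exists_subset_card_eq (s := S) (n := h) (by rw [hm, mul_add]; omega)
    have hc := card_sdiff_add_card_eq_card hTS
    have := (ih (hS.subset (sdiff_subset (t := T))) (by rw [mul_add] at hm; omega)).union
      (hS.subset hTS) hTc sdiff_disjoint
    rwa [sdiff_union_of_subset hTS] at this

/-- The absorbing property of a transitive tournament `A` on `2 * h` vertices: an outside vertex
adjacent to all but at most two vertices of `A` can be exchanged for any vertex of `A`. -/
theorem tileable_swap {A : Finset V} (hA : IsTransTournament R A) (hc : #A = 2 * h) (hh : 0 < h)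
    {u v : V} (hu : u ∈ A) (hv : v ∉ A) [DecidablePred fun a => ¬ (R v a ∨ R a v)]
    (hadj : #{a ∈ A | ¬ (R v a ∨ R a v)} ≤ 2) : Tileable R h (insert v (A.erase u)) := by
  classical
  have hcB : #(A.erase u) = 2 * h - 1 := by rw [card_erase_of_mem hu, hc]
  -- It suffices to find a tile consisting of `v` and `h - 1` vertices of `A.erase u`.
  have key : ∀ C ⊆ A.erase u, #C = h - 1 → IsTransTournament R (insert v C) →
      Tileable R h (insert v (A.erase u)) := by
    intro C hC hCc hCt
    have hvC : v ∉ C := fun h => hv (mem_of_mem_erase (hC h))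
    have hcard := card_sdiff_add_card_eq_card hC
    have hrest : Tileable R h (A.erase u \ C) :=
      .of_isTransTournament (hA.subset (sdiff_subset.trans (erase_subset _ _))) (by omega)
    have hdisj : Disjoint (A.erase u \ C) (insert v C) := by
      rw [disjoint_insert_right]
      exact ⟨fun h => hv (mem_of_mem_erase (mem_sdiff.1 h).1), sdiff_disjoint⟩
    have := hrest.union hCt (by rw [card_insert_of_notMem hvC]; omega) hdisj
    rwa [union_insert, sdiff_union_of_subset hC] at this
  have hsplit : #(A.erase u) ≤ #{a ∈ A.erase u | R v a} + #{a ∈ A.erase u | R a v} + 2 := by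
    have h1 := card_filter_add_card_filter_not (s := A.erase u) (fun a => R v a ∨ R a v)
    have h2 : #{a ∈ A.erase u | R v a ∨ R a v} ≤
        #{a ∈ A.erase u | R v a} + #{a ∈ A.erase u | R a v} := by
      rw [filter_or]
      exact card_union_le _ _
    have h3 : #{a ∈ A.erase u | ¬ (R v a ∨ R a v)} ≤ 2 :=
      (card_le_card (filter_subset_filter _ (erase_subset u A))).trans (by convert hadj)
    omega
  by_cases hout : h - 1 ≤ #{a ∈ A.erase u | R v a}
  · obtain ⟨C, hC, hCc⟩ := exists_subset_card_eq hout
    have hCA := hC.trans (filter_subset _ _)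
    exact key C hCA hCc ((hA.subset (hCA.trans (erase_subset _ _))).insert_source
      fun x hx => (mem_filter.1 (hC hx)).2)
  · obtain ⟨C, hC, hCc⟩ := exists_subset_card_eq (s := {a ∈ A.erase u | R a v}) (n := h - 1)
      (by omega)
    have hCA := hC.trans (filter_subset _ _)
    exact key C hCA hCc ((hA.subset (hCA.trans (erase_subset _ _))).insert_sink
      fun x hx => (mem_filter.1 (hC hx)).2)

end IsTransTournament

/-! ### Absorbing the leftover vertices -/

/-- The number of tiles of a disjoint family that contain at least three members of a set `N` is at
most a third of `#N`. -/
theorem three_mul_card_filter_le {V : Type*} [DecidableEq V] {𝒜 : Finset (Finset V)}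
    (hdisj : (𝒜 : Set (Finset V)).PairwiseDisjoint id) (N : Finset V) :
    3 * #{A ∈ 𝒜 | 2 < #(A ∩ N)} ≤ #N := by
  have h1 : #({A ∈ 𝒜 | 2 < #(A ∩ N)}.biUnion fun A => A ∩ N) =
      ∑ A ∈ 𝒜 with 2 < #(A ∩ N), #(A ∩ N) := by
    refine card_biUnion fun A hA B hB hne => ?_
    have := hdisj (mem_filter.1 hA).1 (mem_filter.1 hB).1 hne
    exact this.mono inter_subset_left inter_subset_left
  have h2 : #({A ∈ 𝒜 | 2 < #(A ∩ N)}.biUnion fun A => A ∩ N) ≤ #N :=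
    card_le_card (biUnion_subset.2 fun A _ => inter_subset_right)
  have h3 := card_nsmul_le_sum {A ∈ 𝒜 | 2 < #(A ∩ N)} (fun A => #(A ∩ N)) 3
    fun A hA => (mem_filter.1 hA).2
  rw [smul_eq_mul] at h3
  omega

/-- Exchange step: `h` leftover vertices `K` can be absorbed, together with suitable `h` members of
a sufficiently large disjoint family of transitive tournaments on `2 * h` vertices. -/
theorem exists_absorbing_subfamily {V : Type*} [Fintype V] [DecidableEq V] {R : V → V → Prop}
    (hirr : ∀ x, ¬ R x x) [∀ v, DecidablePred fun u => ¬ (R v u ∨ R u v)]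
    {d h : ℕ} (hh : 0 < h) (hR : ∀ v, #{u | ¬ (R v u ∨ R u v)} ≤ d)
    {𝒜 : Finset (Finset V)} (h𝒜 : ∀ A ∈ 𝒜, IsTransTournament R A ∧ #A = 2 * h)
    (hdisj : (𝒜 : Set (Finset V)).PairwiseDisjoint id) {K : Finset V}
    (hK : Disjoint (𝒜.biUnion id) K) (hKc : #K = h)
    (hlarge : 2 * h * (h * d) + 3 * ((2 ^ (h - 1) - 1) * (d + 2 * h)) < 6 * h * #𝒜) :
    ∃ ℬ ⊆ 𝒜, #ℬ = h ∧ Tileable R h (ℬ.biUnion id ∪ K) := by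
  classical
  let N : V → Finset V := fun v => {u | ¬ (R v u ∨ R u v)}
  -- The members of the family that can absorb every vertex of `K`.
  let 𝒢 := {A ∈ 𝒜 | ∀ v ∈ K, #(A ∩ N v) ≤ 2}
  have h𝒢 : 3 * #𝒜 ≤ 3 * #𝒢 + h * d := by
    have h1 := card_filter_add_card_filter_not (s := 𝒜) (fun A => ∀ v ∈ K, #(A ∩ N v) ≤ 2)
    have h2 : {A ∈ 𝒜 | ¬ ∀ v ∈ K, #(A ∩ N v) ≤ 2} ⊆
        K.biUnion fun v => {A ∈ 𝒜 | 2 < #(A ∩ N v)} := by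
      intro A hA
      simp only [mem_filter, not_forall, not_le, mem_biUnion] at hA ⊢
      obtain ⟨hA, v, hv, hAv⟩ := hA
      exact ⟨v, hv, hA, hAv⟩
    have h3 := (card_le_card h2).trans card_biUnion_le
    have h4 : ∑ v ∈ K, 3 * #{A ∈ 𝒜 | 2 < #(A ∩ N v)} ≤ ∑ v ∈ K, d :=
      sum_le_sum fun v _ => (three_mul_card_filter_le hdisj _).trans (hR v)
    rw [← mul_sum, sum_const, smul_eq_mul, hKc] at h4
    change 3 * #𝒜 ≤ 3 * #{A ∈ 𝒜 | ∀ v ∈ K, #(A ∩ N v) ≤ 2} + h * d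
    omega
  have h𝒢𝒜 : 𝒢 ⊆ 𝒜 := filter_subset _ _
  have hU : #(𝒢.biUnion id) = 2 * h * #𝒢 := by
    rw [card_biUnion fun A hA B hB hne => hdisj (h𝒢𝒜 hA) (h𝒢𝒜 hB) hne, mul_comm]
    exact sum_const_nat fun A hA => (h𝒜 A (h𝒢𝒜 hA)).2
  -- Forbidding edges inside a member of the family forces the vertices of the new tile to lie in
  -- distinct members; this costs at most `2 * h` further non-neighbours per vertex.
  let R' : V → V → Prop := fun x y => R x y ∧ ∀ A ∈ 𝒢, x ∈ A → y ∉ A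
  obtain ⟨T, hTU, hTc, hTt⟩ : ∃ T ⊆ 𝒢.biUnion id, #T = (h - 1) + 1 ∧ IsTransTournament R' T := by
    refine exists_isTransTournament (d := d + 2 * h) (fun x hx => hirr x hx.1) _ _ ?_ ?_
    · intro v hv
      obtain ⟨A, hA, hvA⟩ := mem_biUnion.1 hv
      have hsub : {u ∈ 𝒢.biUnion id | ¬ (R' v u ∨ R' u v)} ⊆ N v ∪ A := by
        intro u hu
        by_contra hcon
        rw [mem_union, not_or] at hcon
        have hadj : R v u ∨ R u v := by
          by_contra hna
          exact hcon.1 (mem_filter.2 ⟨mem_univ u, hna⟩)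
        have huniq : ∀ B ∈ 𝒢, v ∈ B → B = A := fun B hB hvB => by
          by_contra hne
          exact disjoint_left.1 (hdisj (h𝒢𝒜 hB) (h𝒢𝒜 hA) hne) hvB hvA
        refine (mem_filter.1 hu).2 (hadj.imp (fun h => ⟨h, fun B hB hvB huB => ?_⟩)
          fun h => ⟨h, fun B hB huB hvB => hcon.2 (huniq B hB hvB ▸ huB)⟩)
        exact hcon.2 (huniq B hB hvB ▸ huB)
      refine (card_le_card hsub).trans ((card_union_le _ _).trans (add_le_add (hR v) ?_))
      exact (h𝒜 A (h𝒢𝒜 hA)).2.le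
    · rw [hU]
      have : 2 * h * (3 * #𝒜) ≤ 2 * h * (3 * #𝒢 + h * d) := Nat.mul_le_mul_left _ h𝒢
      nlinarith
  replace hTc : #T = h := by omega
  choose! f hf using fun x (hx : x ∈ T) => mem_biUnion.1 (hTU hx)
  have hf𝒢 : ∀ x ∈ T, f x ∈ 𝒢 := fun x hx => (hf x hx).1
  have hmem : ∀ x ∈ T, x ∈ f x := fun x hx => (hf x hx).2
  have hinj : Set.InjOn f T := by
    intro x hx y hy hxy
    by_contra hne
    rcases hTt.total hx hy hne with hr | hr
    · exact hr.2 (f x) (hf𝒢 x hx) (hmem x hx) (hxy ▸ hmem y hy)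
    · exact hr.2 (f y) (hf𝒢 y hy) (hmem y hy) (hxy ▸ hmem x hx)
  obtain ⟨g, hg⟩ : ∃ g : V → V, Set.BijOn g T K := by
    have e : T ≃ K := Finset.equivOfCardEq (hTc.trans hKc.symm)
    refine ⟨fun x => if hx : x ∈ T then e ⟨x, hx⟩ else x, ?_, ?_, ?_⟩
    · intro x hx
      have hx' : x ∈ T := hx
      simp [hx']
    · intro x hx y hy hxy
      have hx' : x ∈ T := hx
      have hy' : y ∈ T := hy
      simpa [hx', hy', Subtype.ext_iff] using hxy
    · intro y hy
      exact ⟨e.symm ⟨y, hy⟩, (e.symm ⟨y, hy⟩).2, by simp⟩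
  have hK' : ∀ x ∈ T, ∀ A ∈ 𝒜, g x ∉ A := fun x hx A hA hgA =>
    disjoint_left.1 hK (mem_biUnion.2 ⟨A, hA, hgA⟩) (hg.mapsTo hx)
  refine ⟨T.image f, ?_, ?_, ?_⟩
  · exact image_subset_iff.2 fun x hx => h𝒢𝒜 (hf𝒢 x hx)
  · rw [card_image_of_injOn hinj, hTc]
  have hswap : Tileable R h (T.biUnion fun x => insert (g x) ((f x).erase x)) := by
    refine Tileable.biUnion (fun x hx => ?_) ?_
    · have hfx := h𝒜 _ (h𝒢𝒜 (hf𝒢 x hx))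
      refine hfx.1.tileable_swap hfx.2 hh (hmem x hx) (hK' x hx _ (h𝒢𝒜 (hf𝒢 x hx))) ?_
      have := (mem_filter.1 (hf𝒢 x hx)).2 (g x) (hg.mapsTo hx)
      convert this using 2
      ext a
      simp [N]
    · intro x hx y hy hne
      have hfd : Disjoint (f x) (f y) :=
        hdisj (h𝒢𝒜 (hf𝒢 x hx)) (h𝒢𝒜 (hf𝒢 y hy)) (hinj.ne hx hy hne)
      simp only [Function.onFun, disjoint_insert_left, disjoint_insert_right, mem_insert, not_or]
      refine ⟨⟨?_, fun h => hK' y hy _ (h𝒢𝒜 (hf𝒢 x hx)) (mem_of_mem_erase h)⟩,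
        fun h => hK' x hx _ (h𝒢𝒜 (hf𝒢 y hy)) (mem_of_mem_erase h),
        hfd.mono (erase_subset _ _) (erase_subset _ _)⟩
      exact fun h => hne (hg.injOn hx hy h.symm)
  have hTdisj : Disjoint (T.biUnion fun x => insert (g x) ((f x).erase x)) T := by
    rw [disjoint_left]
    intro y hy hyT
    obtain ⟨x, hx, hyx⟩ := mem_biUnion.1 hy
    rcases mem_insert.1 hyx with rfl | hyx
    · exact hK' x hx _ (h𝒢𝒜 (hf𝒢 _ hyT)) (hmem _ hyT)
    · refine (mem_erase.1 hyx).1 ?_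
      by_contra hne
      exact disjoint_left.1 (hdisj (h𝒢𝒜 (hf𝒢 x hx)) (h𝒢𝒜 (hf𝒢 y hyT))
        (hinj.ne hx hyT (Ne.symm hne))) (mem_of_mem_erase hyx) (hmem y hyT)
  have hfin := hswap.union (hTt.mono fun x y hxy => hxy.1) hTc hTdisj
  convert hfin using 1
  ext y
  simp only [mem_union, mem_biUnion, mem_image, id, exists_exists_and_eq_and, mem_insert, mem_erase]
  constructor
  · rintro (⟨x, hx, hy⟩ | hy)
    · by_cases hyx : y = x
      · exact .inr (hyx ▸ hx)
      · exact .inl ⟨x, hx, .inr ⟨hyx, hy⟩⟩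
    · obtain ⟨x, hx, rfl⟩ := hg.surjOn hy
      exact .inl ⟨x, hx, .inl rfl⟩
  · rintro (⟨x, hx, rfl | hy⟩ | hy)
    · exact .inr (hg.mapsTo hx)
    · exact .inl ⟨x, hx, hy.2⟩
    · exact .inl ⟨y, hy, hmem y hy⟩

/-- A leftover set `L` whose size is divisible by `h` can be absorbed by a sufficiently large
disjoint family of transitive tournaments on `2 * h` vertices. -/
theorem tileable_biUnion_union {V : Type*} [Fintype V] [DecidableEq V] {R : V → V → Prop}
    (hirr : ∀ x, ¬ R x x) [∀ v, DecidablePred fun u => ¬ (R v u ∨ R u v)]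
    {d h : ℕ} (hh : 0 < h) (hR : ∀ v, #{u | ¬ (R v u ∨ R u v)} ≤ d) (m : ℕ)
    {𝒜 : Finset (Finset V)} (h𝒜 : ∀ A ∈ 𝒜, IsTransTournament R A ∧ #A = 2 * h)
    (hdisj : (𝒜 : Set (Finset V)).PairwiseDisjoint id) {L : Finset V}
    (hL : Disjoint (𝒜.biUnion id) L) (hLc : #L = h * m)
    (hlarge : 6 * h * #L + 2 * h * (h * d) + 3 * ((2 ^ (h - 1) - 1) * (d + 2 * h)) <
      6 * h * #𝒜) :
    Tileable R h (𝒜.biUnion id ∪ L) := by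
  induction m generalizing 𝒜 L with
  | zero =>
    obtain rfl : L = ∅ := card_eq_zero.1 (by simpa using hLc)
    rw [union_empty]
    exact Tileable.biUnion (fun A hA => (h𝒜 A hA).1.tileable (by simp [(h𝒜 A hA).2])) hdisj
  | succ m ih =>
    obtain ⟨K, hKL, hKc⟩ := exists_subset_card_eq (s := L) (n := h) (by rw [hLc, mul_add]; omega)
    obtain ⟨ℬ, hℬ, hℬc, hℬt⟩ := exists_absorbing_subfamily hirr hh hR h𝒜 hdisj
      (hL.mono_right hKL) hKc (by omega)
    have hLK := card_sdiff_add_card_eq_card hKL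
    have h𝒜ℬ := card_sdiff_add_card_eq_card hℬ
    have hrest : Tileable R h ((𝒜 \ ℬ).biUnion id ∪ (L \ K)) := by
      refine ih (fun A hA => h𝒜 A (mem_sdiff.1 hA).1) (hdisj.subset (by simp)) ?_ ?_ ?_
      · exact hL.mono (biUnion_subset_biUnion_of_subset_left _ sdiff_subset) sdiff_subset
      · rw [mul_add] at hLc
        omega
      · rw [← hLK, ← h𝒜ℬ, hKc, hℬc, mul_add (6 * h) #(L \ K), mul_add (6 * h) #(𝒜 \ ℬ)] at hlarge
        omega
    have hd : Disjoint ((𝒜 \ ℬ).biUnion id ∪ (L \ K)) (ℬ.biUnion id ∪ K) := by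
      rw [disjoint_union_left, disjoint_union_right, disjoint_union_right]
      refine ⟨⟨?_, ?_⟩, ?_, sdiff_disjoint⟩
      · rw [disjoint_biUnion_left]
        intro A hA
        rw [disjoint_biUnion_right]
        intro B hB
        rw [mem_sdiff] at hA
        exact hdisj hA.1 (hℬ hB) fun h => hA.2 (h ▸ hB)
      · exact hL.mono (biUnion_subset_biUnion_of_subset_left _ sdiff_subset) hKL
      · exact (hL.mono (biUnion_subset_biUnion_of_subset_left _ hℬ) sdiff_subset).symm
    convert hrest.disjoint_union hℬt hd using 1
    rw [union_union_union_comm, ← union_biUnion, sdiff_union_of_subset hℬ,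
      sdiff_union_of_subset hKL]

/-! ### Tiling relations with few non-adjacent pairs -/

/-- The absorbers that the greedy choice provides outnumber those needed for the leftover. -/
theorem absorber_count {h : ℕ} (hh : 0 < h) {n d a l : ℕ} (hn : 4 ^ h * d + 16 ^ h ≤ n)
    (ha : n ≤ 2 * h * a + (2 ^ (2 * h - 1) - 1) * d) (hl : l ≤ (2 ^ (h - 1) - 1) * d) :
    6 * h * l + 2 * h * (h * d) + 3 * ((2 ^ (h - 1) - 1) * (d + 2 * h)) < 6 * h * a := by
  obtain ⟨k, rfl⟩ : ∃ k, h = k + 1 := ⟨h - 1, by omega⟩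
  obtain ⟨x, hx⟩ : ∃ x, 2 ^ k = x + 1 := ⟨2 ^ k - 1, by have := Nat.one_le_two_pow (n := k); omega⟩
  have e1 : 4 ^ (k + 1) = 4 * (x + 1) ^ 2 := by
    rw [← hx, pow_succ, show 4 = 2 ^ 2 by norm_num, ← pow_mul, ← pow_mul]; ring
  have e2 : 16 ^ (k + 1) = 16 * (x + 1) ^ 4 := by
    rw [← hx, pow_succ, show 16 = 2 ^ 4 by norm_num, ← pow_mul, ← pow_mul]; ring
  have e3 : 2 ^ (2 * (k + 1) - 1) - 1 = 2 * (x + 1) ^ 2 - 1 := by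
    rw [← hx, show 2 * (k + 1) - 1 = k * 2 + 1 by omega, pow_succ, pow_mul]; ring_nf
  have e4 : 2 ^ (k + 1 - 1) - 1 = x := by simp [hx]
  rw [e1, e2] at hn
  rw [e3] at ha
  rw [e4] at hl ⊢
  obtain ⟨y, hy⟩ : ∃ y, 2 * (x + 1) ^ 2 = y + 1 := ⟨2 * x ^ 2 + 4 * x + 1, by ring⟩
  rw [hy, Nat.add_sub_cancel] at ha
  have hkx : k ≤ x := by have := Nat.lt_two_pow_self (n := k); omega
  -- The coefficients of `d`; for `k ≥ 3` this follows from `2 * (k + 1) ≤ 2 ^ k`.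
  have hcoef : 6 * (k + 1) * x + 2 * (k + 1) ^ 2 + 3 * x ≤ 6 * (x + 1) ^ 2 + 3 := by
    rcases lt_or_ge k 3 with hk | hk
    · interval_cases k
      · obtain rfl : x = 0 := by omega
        norm_num
      · obtain rfl : x = 1 := by omega
        norm_num
      · obtain rfl : x = 3 := by omega
        norm_num
    · have h2 : 2 * (k + 1) ≤ x + 1 := by
        rw [← hx]
        clear * - hk
        induction k, hk using Nat.le_induction with
        | base => norm_num
        | succ k _ ih => rw [pow_succ]; omega
      nlinarith
  -- The terms without `d`.
  have hconst : 6 * (k + 1) * x < 48 * (x + 1) ^ 4 := by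
    have h1 : (k + 1) * x ≤ (x + 1) ^ 2 := by nlinarith
    have h2 : (x + 1) ^ 2 ≤ (x + 1) ^ 4 := Nat.pow_le_pow_right (by omega) (by omega)
    have h3 : 0 < (x + 1) ^ 4 := by positivity
    nlinarith
  have hd := Nat.mul_le_mul_right d hcoef
  have hl' := Nat.mul_le_mul_left (6 * (k + 1)) hl
  have hy' : 6 * (x + 1) ^ 2 * d = 3 * (y * d) + 3 * d := by
    rw [show 6 * (x + 1) ^ 2 = 3 * (2 * (x + 1) ^ 2) by ring, hy]; ring
  nlinarith

theorem tileable_univ {V : Type*} [Fintype V] [DecidableEq V] {R : V → V → Prop}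
    (hirr : ∀ x, ¬ R x x) [∀ v, DecidablePred fun u => ¬ (R v u ∨ R u v)]
    {d h : ℕ} (hh : 0 < h) (hR : ∀ v, #{u | ¬ (R v u ∨ R u v)} ≤ d)
    (hdvd : h ∣ Fintype.card V) (hn : 4 ^ h * d + 16 ^ h ≤ Fintype.card V) :
    Tileable R h (univ : Finset V) := by
  have hR' : ∀ S : Finset V, ∀ v ∈ S, #{u ∈ S | ¬ (R v u ∨ R u v)} ≤ d := fun S v _ =>
    (card_le_card (filter_subset_filter _ (subset_univ S))).trans (hR v)
  obtain ⟨𝒜, h𝒜, h𝒜d, -, h𝒜c⟩ := exists_greedy_family hirr (2 * h - 1) univ (hR' _)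
  obtain ⟨ℬ, hℬ, hℬd, hℬs, hℬc⟩ := exists_greedy_family hirr (h - 1) (univ \ 𝒜.biUnion id) (hR' _)
  have h𝒜' : ∀ A ∈ 𝒜, IsTransTournament R A ∧ #A = 2 * h := fun A hA =>
    ⟨(h𝒜 A hA).1, by rw [(h𝒜 A hA).2]; omega⟩
  have hℬ' : ∀ B ∈ ℬ, IsTransTournament R B ∧ #B = h := fun B hB =>
    ⟨(hℬ B hB).1, by rw [(hℬ B hB).2]; omega⟩
  set L := (univ \ 𝒜.biUnion id) \ ℬ.biUnion id with hL
  have hcA : #(𝒜.biUnion id) = 2 * h * #𝒜 := by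
    rw [card_biUnion fun A hA B hB hne => h𝒜d hA hB hne, mul_comm]
    exact sum_const_nat fun A hA => (h𝒜' A hA).2
  have hcB : #(ℬ.biUnion id) = h * #ℬ := by
    rw [card_biUnion fun A hA B hB hne => hℬd hA hB hne, mul_comm]
    exact sum_const_nat fun A hA => (hℬ' A hA).2
  have hc1 := card_sdiff_add_card_eq_card (subset_univ (𝒜.biUnion id))
  have hc2 := card_sdiff_add_card_eq_card hℬs
  rw [← hL] at hc2
  rw [card_univ, hcA] at hc1
  rw [hcB] at hc2
  obtain ⟨m, hm⟩ : h ∣ #L := by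
    have h1 : h ∣ #L + (h * #ℬ + 2 * h * #𝒜) := by
      have : #L + (h * #ℬ + 2 * h * #𝒜) = Fintype.card V := by omega
      rwa [this]
    exact (Nat.dvd_add_left (Dvd.intro (#ℬ + 2 * #𝒜) (by ring))).1 h1
  have hdisj : Disjoint (𝒜.biUnion id) L :=
    disjoint_sdiff_self_right.mono_right sdiff_subset
  have h1 := tileable_biUnion_union hirr hh hR m h𝒜' h𝒜d hdisj hm
    (absorber_count hh hn (by omega) hℬc)
  have h2 : Tileable R h (ℬ.biUnion id) :=
    Tileable.biUnion (fun B hB => Tileable.of_isTransTournament (hℬ' B hB).1 (hℬ' B hB).2) hℬd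
  have hd : Disjoint (𝒜.biUnion id ∪ L) (ℬ.biUnion id) :=
    disjoint_union_left.2 ⟨disjoint_sdiff_self_right.mono_right hℬs, sdiff_disjoint⟩
  convert h1.disjoint_union h2 hd using 1
  rw [union_assoc, hL, sdiff_union_of_subset hℬs, union_sdiff_of_subset (subset_univ _)]

/-! ### From transitive tournaments to acyclic digraphs -/

/-- A finite acyclic digraph has a topological ordering. -/
theorem IsAcyclic.exists_equiv_fin {W : Type*} [Fintype W] {H : Digraph W} (hH : H.IsAcyclic) :
    ∃ e : W ≃ Fin (Fintype.card W), ∀ a b, H.Adj a b → e a < e b := by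
  classical
  have : IsPartialOrder W (Relation.ReflTransGen H.Adj) :=
    { refl := fun _ => .refl
      trans := fun _ _ _ => .trans
      antisymm := fun a b hab hba => by
        rcases Relation.reflTransGen_iff_eq_or_transGen.1 hab with h | h
        · exact h.symm
        · exact absurd (h.trans_left hba) (hH a) }
  obtain ⟨s, hs, hrs⟩ := extend_partialOrder (Relation.ReflTransGen H.Adj)
  let : LinearOrder W :=
    { le := s
      le_refl := hs.refl
      le_trans := hs.trans
      le_antisymm := hs.antisymm
      le_total := hs.total
      toDecidableLE := Classical.decRel _ }
  let e := Fintype.orderIsoFinOfCardEq W rfl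
  refine ⟨e.symm.toEquiv, fun a b hab => ?_⟩
  have hle : a ≤ b := hrs a b (.single hab)
  have hne : a ≠ b := by
    rintro rfl
    exact hH a (.single hab)
  exact e.symm.lt_iff_lt.2 (lt_of_le_of_ne hle hne)

theorem IsTransTournament.exists_copy {V W : Type*} [Fintype W] {H : Digraph W}
    (hH : H.IsAcyclic) {D : Digraph V} (hirr : ∀ x, ¬ D.Adj x x) {S : Finset V}
    (hS : IsTransTournament D.Adj S) (hc : #S = Fintype.card W) :
    ∃ c : Copy H D, c.verts = S := by
  classical
  obtain ⟨e, he⟩ := hH.exists_equiv_fin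
  obtain ⟨l, hl, hm⟩ := hS
  have hnd : l.Nodup := hl.imp fun {a b} hab => by
    rintro rfl
    exact hirr a hab
  have hlen : Fintype.card W = l.length := by
    rw [← hc, ← List.toFinset_card_of_nodup hnd]
    congr 1
    ext x
    simp [hm]
  refine ⟨⟨⟨fun a => l.get (Fin.cast hlen (e a)), fun a b hab => ?_⟩, fun a b hab => ?_⟩, ?_⟩
  · simpa using (List.nodup_iff_injective_get.1 hnd) hab
  · exact List.pairwise_iff_get.1 hl _ _ (by simpa using he a b hab)
  · ext x
    simp only [Copy.verts, Set.mem_range, mem_coe, ← hm]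
    constructor
    · rintro ⟨a, rfl⟩
      exact List.get_mem _ _
    · intro hx
      obtain ⟨i, rfl⟩ := List.get_of_mem hx
      exact ⟨e.symm (Fin.cast hlen.symm i), by simp⟩

theorem Tileable.exists_copies {V W : Type*} [DecidableEq V] [Fintype W] {H : Digraph W}
    (hH : H.IsAcyclic) {D : Digraph V} (hirr : ∀ x, ¬ D.Adj x x) {S : Finset V}
    (hS : Tileable D.Adj (Fintype.card W) S) :
    ∃ F : Set (Copy H D), F.Pairwise (fun c c' => Disjoint c.verts c'.verts) ∧
      ⋃ c ∈ F, c.verts = S := by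
  induction hS with
  | empty => exact ⟨∅, by simp, by simp⟩
  | @union S T _ hT hc hd ih =>
    obtain ⟨F, hF, hFS⟩ := ih
    obtain ⟨c, hcT⟩ := hT.exists_copy hH hirr hc
    refine ⟨insert c F, hF.insert fun c' hc' _ => ?_, ?_⟩
    · rw [hcT, disjoint_comm (a := c'.verts), and_self]
      refine (disjoint_coe.2 hd).symm.mono_right ?_
      rw [← hFS]
      exact Set.subset_biUnion_of_mem (u := Copy.verts) hc'
    · rw [Set.biUnion_insert, hFS, hcT, coe_union, Set.union_comm]

end Digraph

theorem theorem2 {V W : Type*} [Fintype V] [Fintype W]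
    (H : Digraph W) (hH : H.IsAcyclic)
    (G : SimpleGraph V) [DecidableRel G.Adj]
    (hdvd : Fintype.card W ∣ Fintype.card V)
    (hdeg : (Fintype.card V : ℝ) * (1 - 1 / (4 : ℝ) ^ Fintype.card W) + (4 : ℝ) ^ Fintype.card W
      ≤ (G.minDegree : ℝ))
    (D : Digraph V) (hD : D.IsOrientation G) :
    D.HasFactor H := by
  classical
  have hirr : ∀ x, ¬ D.Adj x x := fun x hx => hD.asymm x x hx hx
  suffices h : Digraph.Tileable D.Adj (Fintype.card W) (Finset.univ : Finset V) by
    simpa [Digraph.HasFactor] using h.exists_copies hH hirr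
  rcases Nat.eq_zero_or_pos (Fintype.card W) with h0 | hpos
  · have hempty : Digraph.Tileable D.Adj (Fintype.card W) ∅ := .empty
    rw [h0, zero_dvd_iff, Fintype.card_eq_zero_iff] at hdvd
    rwa [Finset.eq_empty_of_isEmpty Finset.univ]
  have hnon : ∀ v, (Finset.univ.filter fun u => ¬ (D.Adj v u ∨ D.Adj u v)).card ≤
      Fintype.card V - G.minDegree := by
    intro v
    have h1 := Finset.card_filter_add_card_filter_not (s := Finset.univ) (fun u => G.Adj v u)
    have h2 := G.minDegree_le_degree v
    rw [← SimpleGraph.card_neighborFinset_eq_degree, SimpleGraph.neighborFinset_eq_filter] at h2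
    simp only [← hD.adj_iff]
    rw [Finset.card_univ] at h1
    omega
  refine Digraph.tileable_univ hirr hpos hnon hdvd ?_
  have hle : G.minDegree ≤ Fintype.card V := by
    rcases isEmpty_or_nonempty V with hV | hV
    · simp
    · exact G.minDegree_lt_card.le
  have hreal : (4 : ℝ) ^ Fintype.card W * ((Fintype.card V : ℝ) - G.minDegree) +
      16 ^ Fintype.card W ≤ Fintype.card V := by
    have hp : (0 : ℝ) < 4 ^ Fintype.card W := by positivity
    have h16 : (16 : ℝ) ^ Fintype.card W = 4 ^ Fintype.card W * 4 ^ Fintype.card W := by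
      rw [← mul_pow]; norm_num
    have := mul_le_mul_of_nonneg_left hdeg hp.le
    have h1 : (4 : ℝ) ^ Fintype.card W * ((Fintype.card V : ℝ) * (1 - 1 / 4 ^ Fintype.card W)) =
        4 ^ Fintype.card W * Fintype.card V - Fintype.card V := by
      field_simp
    rw [mul_add, h1] at this
    rw [h16]
    linarith
  have : ((4 ^ Fintype.card W * (Fintype.card V - G.minDegree) + 16 ^ Fintype.card W : ℕ) : ℝ) ≤
      (Fintype.card V : ℕ) := by
    push_cast [Nat.cast_sub hle]
    exact hreal
  exact_mod_cast this
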